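/- Let $0\le k\le n$ be integers and let $C=[-1,1]^n\subset\mathbb R^n$. Choose a random orientation, i.e. a random $k$-tuple $(v_1,\dots,v_k)$ of unit vectors of $\mathbb R^n$ with an arbitrary joint (Borel) distribution $\mu$ under which the $v_i$ are almost surely linearly independent. Put $L=\operatorname{span}\{v_1,\dots,v_k\}$. Given the orientation, choose the translation $\tau$ uniformly (with respect to $(n-k)$-dimensional Lebesgue measure on the orthogonal complement $L^\perp$) from the set $\{\tau\in L^\perp : (\tau+L)\cap C\neq\emptyset\}$. Then the expected number of vertices (extreme points) of the random $k$-slice $C\cap(\tau+L)$ is $2^k$. In particular this applies to the isotropic distribution of orientations: if $v_1,\dots,v_k$ are independent and uniformly distributed on the unit sphere $S^{n-1}$, then they are almost surely linearly independent, and with $\tau$ chosen as above the expected number of vertices of the random $k$-slice of $C$ is $2^k$. -/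

import Mathlib

open MeasureTheory ProbabilityTheory
open scoped ENNReal

noncomputable section

namespace CubeSlice

/-- The ambient Euclidean space of dimension `n`. -/
abbrev E (n : ℕ) : Type := EuclideanSpace ℝ (Fin n)

/-- The hypercube `[-1, 1]^n`. -/
def cube (n : ℕ) : Set (E n) := {x | ∀ i, x i ∈ Set.Icc (-1 : ℝ) 1}

/-- Orientation data: `k` unit vectors of the `n`-dimensional Euclidean space. -/
abbrev Orientation (n k : ℕ) : Type := Fin k → Metric.sphere (0 : E n) 1

/-- The vectors of an orientation, in the ambient space. -/
def vectors {n k : ℕ} (v : Orientation n k) : Fin k → E n := fun i => (v i : E n)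

/-- The linear span of the vectors of an orientation. -/
def direction {n k : ℕ} (v : Orientation n k) : Submodule ℝ (E n) :=
  Submodule.span ℝ (Set.range (vectors v))

/-- The flat `τ + span {v_1, …, v_k}`. -/
def flat {n k : ℕ} (v : Orientation n k) (τ : E n) : AffineSubspace ℝ (E n) :=
  AffineSubspace.mk' τ (direction v)

/-- The slice of the cube by the flat `τ + span {v_1, …, v_k}`. -/
def slice {n k : ℕ} (v : Orientation n k) (τ : E n) : Set (E n) :=
  cube n ∩ (flat v τ : Set (E n))

/-- The number of vertices (extreme points) of the slice given by an orientation and a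
translation. -/
def vertexCount {n k : ℕ} (p : Orientation n k × E n) : ℝ≥0∞ :=
  ((Set.extremePoints ℝ (slice p.1 p.2)).encard : ℝ≥0∞)

/-- The translations, in the normal space of the orientation, for which the flat meets the
cube. -/
def translations {n k : ℕ} (v : Orientation n k) : Set ((direction v)ᗮ : Submodule ℝ (E n)) :=
  {τ | (slice v (τ : E n)).Nonempty}

/-- The uniform distribution on the translations for which the flat meets the cube: Lebesgue
measure of the normal space, conditioned on that set, viewed as a measure on the ambient space. -/
def translationLaw {n k : ℕ} (v : Orientation n k) : Measure (E n) :=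
  (ProbabilityTheory.cond (volume : Measure ((direction v)ᗮ : Submodule ℝ (E n)))
    (translations v)).map Subtype.val

/-- The joint law of (orientation, translation) of a random flat: the orientation has law `μ`, and
given the orientation, the translation is uniform among those for which the flat meets the cube. -/
def randomFlatLaw {n k : ℕ} (μ : Measure (Orientation n k)) : Measure (Orientation n k × E n) :=
  μ.bind (fun v => (translationLaw v).map (Prod.mk v))

/-- The uniform distribution on the unit sphere (normalized surface measure). -/
def sphereUniform (n : ℕ) : Measure (Metric.sphere (0 : E n) 1) :=
  ProbabilityTheory.cond (volume : Measure (E n)).toSphere Set.univ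

/-- The isotropic distribution of orientations: `k` independent uniform unit vectors. -/
def isotropic (n k : ℕ) : Measure (Orientation n k) :=
  Measure.pi (fun _ => sphereUniform n)

end CubeSlice

end

/-! Fix `L` and integrate over `τ`. A point of a slice is a vertex exactly when `L` meets the
directions of its open face only in 0 (`mem_extremePoints_sliceBy`), so the vertex count is a sum of
indicators over faces, and its integral is a sum of volumes of faces projected to `Lᗮ`. Faces with
the same set `S` of free coordinates are translates, hence have equal projected volume. That volume
vanishes unless the coordinate subspace of `S` is complementary to `L`, and then there are `2 ^ (n -
|S|) = 2 ^ dim L` such faces.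

It remains to tile the projected cube, up to null sets, with one face for each complementary `S`.
This is linear programming: maximise a generic functional `φ` over the slice. For almost every `τ` a
maximum sits at a vertex with complementary `S`, and the signs of its fixed coordinates are those of
the reduced costs of `φ`, so `S` determines the face. Conversely, a point of the slice on such a
face is the only maximiser, so these faces have disjoint projections. Thus every `L` already has
mean `2 ^ dim L` (`lintegral_encard_extremePoints`), and averaging over orientations changes
nothing.

The averaging needs measurability in `v`, although the space `Lᗮ` varies with `v`;
`translationLaw_eq_map_normalPart` replaces its Lebesgue measure by that of the ambient space. -/

namespace CubeSlice

variable {n : ℕ}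

/-! ### Open faces of the cube and sign vectors -/

/-- The coordinate subspace of the vectors supported on `S`. -/
def coordSubspace (S : Finset (Fin n)) : Submodule ℝ (E n) where
  carrier := {d | ∀ i, i ∉ S → d i = 0}
  add_mem' := fun {a b} ha hb i hi => by simp [ha i hi, hb i hi]
  zero_mem' := fun i _ => by simp
  smul_mem' := fun c a ha i hi => by simp [ha i hi]

/-- The set of zeros of a sign vector. -/
def zeros (σ : Fin n → SignType) : Finset (Fin n) := Finset.univ.filter (σ · = 0)

theorem mem_zeros {σ : Fin n → SignType} {i : Fin n} : i ∈ zeros σ ↔ σ i = 0 := by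
  simp [zeros]

/-- The relatively open face of the cube described by a sign vector: a coordinate is free where the
sign vanishes, and is equal to the sign elsewhere. -/
def openFace (σ : Fin n → SignType) : Set (E n) :=
  {x | ∀ i, (σ i = 0 → |x i| < 1) ∧ (σ i ≠ 0 → x i = (σ i : ℝ))}

/-- The sign vector of the open face that contains a given point of the cube. -/
noncomputable def facePattern (x : E n) : Fin n → SignType :=
  fun i => if x i = 1 then 1 else if x i = -1 then -1 else 0

theorem openFace_subset_cube (σ : Fin n → SignType) : openFace σ ⊆ cube n := by
  intro x hx i
  obtain ⟨h0, h1⟩ := hx i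
  -- The cases come in the order 0, -1, 1.
  rcases h : σ i with _ | _ | _
  · have := h0 h
    exact ⟨(abs_lt.1 this).1.le, (abs_lt.1 this).2.le⟩
  · have := h1 (by rw [h]; decide)
    rw [this, h]; simp
  · have := h1 (by rw [h]; decide)
    rw [this, h]; simp

theorem facePattern_eq_of_mem {σ : Fin n → SignType} {x : E n} (hx : x ∈ openFace σ) :
    facePattern x = σ := by
  funext i
  obtain ⟨h0, h1⟩ := hx i
  rcases h : σ i with _ | _ | _
  · have h2 := abs_lt.1 (h0 h)
    have : x i ≠ 1 := h2.2.ne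
    have : x i ≠ -1 := h2.1.ne'
    simp [facePattern, *]
  · have := h1 (by rw [h]; decide)
    rw [h] at this
    have : x i = -1 := by simpa using this
    simp [facePattern, this]; norm_num
  · have := h1 (by rw [h]; decide)
    rw [h] at this
    have : x i = 1 := by simpa using this
    simp [facePattern, this]

theorem mem_openFace_facePattern {x : E n} (hx : x ∈ cube n) : x ∈ openFace (facePattern x) := by
  intro i
  have hi := hx i
  by_cases h1 : x i = 1
  · simp [facePattern, h1]
  by_cases h2 : x i = -1
  · have : ¬ ((-1 : ℝ) = 1) := by norm_num
    simp [facePattern, h2, this]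
  · simp only [facePattern, h1, h2, if_false, ne_eq, not_true_eq_false, false_imp_iff, and_true,
      true_imp_iff]
    exact abs_lt.2 ⟨lt_of_le_of_ne hi.1 (Ne.symm h2), lt_of_le_of_ne hi.2 h1⟩

theorem mem_zeros_facePattern {x : E n} {i : Fin n} :
    i ∈ zeros (facePattern x) ↔ x i ≠ 1 ∧ x i ≠ -1 := by
  rw [mem_zeros, facePattern]
  split_ifs <;> simp_all

/-! ### Vertices of a slice -/

/-- The slice of the cube by the flat through `τ` with direction `L`. -/
def sliceBy (L : Submodule ℝ (E n)) (τ : E n) : Set (E n) := {x | x ∈ cube n ∧ x - τ ∈ L}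

theorem slice_eq_sliceBy {k : ℕ} (v : Orientation n k) (τ : E n) :
    slice v τ = sliceBy (direction v) τ := by
  ext x
  simp [slice, sliceBy, flat, AffineSubspace.mem_mk', vsub_eq_sub]

/-- Only the constraints active at `x` restrict the direction; the others are strict and survive a
small step. -/
theorem eventually_add_smul_mem_cube {x d : E n} (hx : x ∈ cube n)
    (h1 : ∀ i, x i = 1 → d i ≤ 0) (h2 : ∀ i, x i = -1 → 0 ≤ d i) :
    ∀ᶠ t : ℝ in nhdsWithin 0 (Set.Ioi 0), x + t • d ∈ cube n := by
  simp only [cube, Set.mem_ofPred_eq, PiLp.add_apply, PiLp.smul_apply, smul_eq_mul, Set.mem_Icc]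
  rw [Filter.eventually_all]
  intro i
  have hc : Filter.Tendsto (fun t : ℝ => x i + t * d i) (nhdsWithin 0 (Set.Ioi 0))
      (nhds (x i)) := by
    have : Filter.Tendsto (fun t : ℝ => x i + t * d i) (nhds 0) (nhds (x i + 0 * d i)) :=
      Continuous.tendsto (by fun_prop) 0
    rw [zero_mul, add_zero] at this
    exact this.mono_left nhdsWithin_le_nhds
  have hpos : ∀ᶠ t : ℝ in nhdsWithin 0 (Set.Ioi 0), 0 < t := self_mem_nhdsWithin
  apply Filter.Eventually.and
  · rcases eq_or_lt_of_le (hx i).1 with h | h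
    · filter_upwards [hpos] with t ht
      have := mul_nonneg ht.le (h2 i h.symm)
      linarith
    · filter_upwards [hc.eventually (lt_mem_nhds h)] with t ht using ht.le
  · rcases eq_or_lt_of_le (hx i).2 with h | h
    · filter_upwards [hpos] with t ht
      have := mul_nonneg ht.le (neg_nonneg.2 (h1 i h))
      linarith
    · filter_upwards [hc.eventually (gt_mem_nhds h)] with t ht using ht.le

theorem isClosed_cube (n : ℕ) : IsClosed (cube n) := by
  have : cube n = ⋂ i, {x : E n | x i ∈ Set.Icc (-1 : ℝ) 1} := by
    ext; simp [cube]
  rw [this]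
  exact isClosed_iInter fun i => isClosed_Icc.preimage (by fun_prop : Continuous fun x : E n => x i)

theorem isCompact_cube (n : ℕ) : IsCompact (cube n) := by
  refine Metric.isCompact_of_isClosed_isBounded (isClosed_cube n) ?_
  refine (Metric.isBounded_closedBall (x := (0 : E n)) (r := Real.sqrt n)).subset ?_
  intro x hx
  rw [mem_closedBall_zero_iff, EuclideanSpace.norm_eq]
  apply Real.sqrt_le_sqrt
  calc ∑ i, ‖x i‖ ^ 2 ≤ ∑ i : Fin n, (1 : ℝ) := by
        refine Finset.sum_le_sum fun i _ => ?_
        have := abs_le.2 (hx i)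
        rw [Real.norm_eq_abs]
        exact pow_le_one₀ (abs_nonneg _) this
    _ = n := by simp

theorem isCompact_sliceBy (L : Submodule ℝ (E n)) (τ : E n) : IsCompact (sliceBy L τ) := by
  have : sliceBy L τ = cube n ∩ (fun x => x - τ) ⁻¹' (L : Set (E n)) := rfl
  rw [this]
  exact (isCompact_cube n).inter_right
    ((Submodule.closed_of_finiteDimensional L).preimage (by fun_prop))

/-- A direction of `L` that moves only free coordinates can be followed both ways, making `x` a
midpoint. Conversely, the ends of a segment through `x` agree wherever `x` has a coordinate ±1, so
their difference moves only free coordinates. -/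
theorem mem_extremePoints_sliceBy {L : Submodule ℝ (E n)} {τ x : E n} :
    x ∈ Set.extremePoints ℝ (sliceBy L τ) ↔
      x ∈ sliceBy L τ ∧ Disjoint L (coordSubspace (zeros (facePattern x))) := by
  constructor
  · intro hx
    refine ⟨hx.1, ?_⟩
    rw [Submodule.disjoint_def]
    intro d hdL hd
    have hd' : ∀ i, x i = 1 ∨ x i = -1 → d i = 0 := fun i hi => hd i (by
      rw [mem_zeros_facePattern]; tauto)
    have e1 := eventually_add_smul_mem_cube (d := d) hx.1.1
      (fun i hi => (hd' i (.inl hi)).le) (fun i hi => (hd' i (.inr hi)).ge)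
    have e2 := eventually_add_smul_mem_cube (d := -d) hx.1.1
      (fun i hi => by simp [hd' i (.inl hi)]) (fun i hi => by simp [hd' i (.inr hi)])
    have e3 : ∀ᶠ t : ℝ in nhdsWithin 0 (Set.Ioi 0), 0 < t := self_mem_nhdsWithin
    obtain ⟨t, h1, h2, ht⟩ := (e1.and (e2.and e3)).exists
    have m1 : x + t • d ∈ sliceBy L τ := ⟨h1, by
      have := L.add_mem hx.1.2 (L.smul_mem t hdL)
      rwa [sub_add_eq_add_sub] at this⟩
    have m2 : x + t • -d ∈ sliceBy L τ := ⟨h2, by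
      have := L.add_mem hx.1.2 (L.smul_mem t (L.neg_mem hdL))
      rwa [sub_add_eq_add_sub] at this⟩
    have := hx.2 m1 m2 ⟨1/2, 1/2, by norm_num, by norm_num, by norm_num, by module⟩
    have h0 : t • d = 0 := by simpa using this
    exact (smul_eq_zero.1 h0).resolve_left ht.ne'
  · rintro ⟨hx, hdisj⟩
    refine ⟨hx, fun y hy z hz hxyz => ?_⟩
    rw [Submodule.disjoint_def] at hdisj
    obtain ⟨a, b, ha, hb, hab, rfl⟩ := hxyz
    have hyz : y - z ∈ L := by
      have := L.sub_mem hy.2 hz.2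
      simpa using this
    have : y - z = 0 := by
      refine hdisj _ hyz fun i hi => ?_
      rw [mem_zeros_facePattern] at hi
      simp only [PiLp.add_apply, PiLp.smul_apply, smul_eq_mul, PiLp.sub_apply] at hi ⊢
      have hyi := hy.1 i
      have hzi := hz.1 i
      simp only [Set.mem_Icc] at hyi hzi
      by_cases h : a * y i + b * z i = 1
      · have h1 : a * (1 - y i) + b * (1 - z i) = 0 := by linear_combination hab - h
        have p1 := mul_nonneg ha.le (sub_nonneg.2 hyi.2)
        have p2 := mul_nonneg hb.le (sub_nonneg.2 hzi.2)
        have q1 : a * (1 - y i) = 0 := by linarith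
        have q2 : b * (1 - z i) = 0 := by linarith
        have r1 := (mul_eq_zero.1 q1).resolve_left ha.ne'
        have r2 := (mul_eq_zero.1 q2).resolve_left hb.ne'
        linarith
      · have h' : a * y i + b * z i = -1 := by tauto
        have h1 : a * (y i + 1) + b * (z i + 1) = 0 := by linear_combination hab + h'
        have p1 := mul_nonneg ha.le (by linarith : 0 ≤ y i + 1)
        have p2 := mul_nonneg hb.le (by linarith : 0 ≤ z i + 1)
        have q1 : a * (y i + 1) = 0 := by linarith
        have q2 : b * (z i + 1) = 0 := by linarith
        have r1 := (mul_eq_zero.1 q1).resolve_left ha.ne'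
        have r2 := (mul_eq_zero.1 q2).resolve_left hb.ne'
        linarith
    have hyz' : y = z := sub_eq_zero.1 this
    subst hyz'
    rw [← add_smul, hab, one_smul]

theorem openFace_sub_mem {σ : Fin n → SignType} {x y : E n} (hx : x ∈ openFace σ)
    (hy : y ∈ openFace σ) : x - y ∈ coordSubspace (zeros σ) := by
  intro i hi
  rw [mem_zeros] at hi
  simp [(hx i).2 hi, (hy i).2 hi]

/-- The translates of `L` that meet the open face of `σ`, given by their base points. -/
def hits (L : Submodule ℝ (E n)) (σ : Fin n → SignType) : Set (E n) :=
  {τ | ∃ x ∈ openFace σ, x - τ ∈ L}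

theorem injOn_facePattern_extremePoints (L : Submodule ℝ (E n)) (τ : E n) :
    Set.InjOn facePattern (Set.extremePoints ℝ (sliceBy L τ)) := by
  intro x hx y hy hxy
  rw [mem_extremePoints_sliceBy] at hx hy
  have h := Submodule.disjoint_def.1 hx.2 (x - y)
    (by simpa using L.sub_mem hx.1.2 hy.1.2)
    (openFace_sub_mem (mem_openFace_facePattern hx.1.1)
      (hxy ▸ mem_openFace_facePattern hy.1.1))
  exact sub_eq_zero.1 h

theorem image_facePattern_extremePoints (L : Submodule ℝ (E n)) (τ : E n) :
    facePattern '' Set.extremePoints ℝ (sliceBy L τ) =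
      {σ | Disjoint L (coordSubspace (zeros σ)) ∧ τ ∈ hits L σ} := by
  ext σ
  constructor
  · rintro ⟨x, hx, rfl⟩
    rw [mem_extremePoints_sliceBy] at hx
    exact ⟨hx.2, x, mem_openFace_facePattern hx.1.1, hx.1.2⟩
  · rintro ⟨hd, x, hx, hxτ⟩
    have := facePattern_eq_of_mem hx
    refine ⟨x, ?_, this⟩
    rw [mem_extremePoints_sliceBy, this]
    exact ⟨⟨openFace_subset_cube σ hx, hxτ⟩, hd⟩

-- Each face counted holds at most one point of the slice, and that point is a vertex.
open Classical in
theorem encard_extremePoints_sliceBy (L : Submodule ℝ (E n)) (τ : E n) :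
    ((Set.extremePoints ℝ (sliceBy L τ)).encard : ℝ≥0∞) =
      ∑ σ : Fin n → SignType,
        if Disjoint L (coordSubspace (zeros σ)) ∧ τ ∈ hits L σ then 1 else 0 := by
  rw [← (injOn_facePattern_extremePoints L τ).encard_image, image_facePattern_extremePoints,
    Set.encard_eq_coe_toFinset_card, Finset.sum_boole, Set.toFinset_ofPred]
  simp

/-! ### Generic functionals and reduced costs -/

/-- The value of a linear functional on the projection onto `L`, along a complementary coordinate
subspace, of a standard basis vector. -/
noncomputable def reducedCost (φ : E n →ₗ[ℝ] ℝ) {L : Submodule ℝ (E n)} {S : Finset (Fin n)}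
    (h : IsCompl L (coordSubspace S)) (i : Fin n) : ℝ :=
  φ (L.projection (coordSubspace S) h (EuclideanSpace.single i 1))

theorem single_mem_coordSubspace {S : Finset (Fin n)} {i : Fin n} :
    EuclideanSpace.single i (1 : ℝ) ∈ coordSubspace S ↔ i ∈ S := by
  constructor
  · intro h
    by_contra hi
    simpa using h i hi
  · intro hi j hj
    have : j ≠ i := fun h => hj (h ▸ hi)
    simp [this]

theorem reducedCost_eq_zero (φ : E n →ₗ[ℝ] ℝ) {L : Submodule ℝ (E n)} {S : Finset (Fin n)}
    (h : IsCompl L (coordSubspace S)) {i : Fin n} (hi : i ∈ S) : reducedCost φ h i = 0 := by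
  rw [reducedCost, (Submodule.projection_apply_eq_zero_iff h).2 (single_mem_coordSubspace.2 hi),
    map_zero]

theorem projection_single_ne_zero {L : Submodule ℝ (E n)} {S : Finset (Fin n)}
    (h : IsCompl L (coordSubspace S)) {i : Fin n} (hi : i ∉ S) :
    L.projection (coordSubspace S) h (EuclideanSpace.single i 1) ≠ 0 := by
  rw [Ne, Submodule.projection_apply_eq_zero_iff h, single_mem_coordSubspace]
  exact hi

/-- These are the edge directions of the simplex method: among the coordinates outside `S`, only the
`i`-th moves. -/
theorem projection_single_apply {L : Submodule ℝ (E n)} {S : Finset (Fin n)}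
    (h : IsCompl L (coordSubspace S)) (i : Fin n) {j : Fin n} (hj : j ∉ S) :
    L.projection (coordSubspace S) h (EuclideanSpace.single i 1) j = if j = i then 1 else 0 := by
  have := Submodule.sub_projection_mem h (EuclideanSpace.single i (1 : ℝ)) j hj
  rw [PiLp.sub_apply, sub_eq_zero] at this
  rw [← this]
  simp

theorem apply_eq_sum_reducedCost (φ : E n →ₗ[ℝ] ℝ) {L : Submodule ℝ (E n)} {S : Finset (Fin n)}
    (h : IsCompl L (coordSubspace S)) {d : E n} (hd : d ∈ L) :
    φ d = ∑ i, d i * reducedCost φ h i := by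
  have h1 : d = ∑ i, d i • EuclideanSpace.single i (1 : ℝ) := by
    have := (EuclideanSpace.basisFun (Fin n) ℝ).sum_repr d
    simpa using this.symm
  conv_lhs => rw [← Submodule.projection_apply_of_mem_left h hd, h1]
  simp [reducedCost]

/-- A linear functional is generic for `L` if none of its reduced costs at a nonbasic coordinate
vanishes. -/
def IsGeneric (φ : E n →ₗ[ℝ] ℝ) (L : Submodule ℝ (E n)) : Prop :=
  ∀ (S : Finset (Fin n)) (h : IsCompl L (coordSubspace S)) (i : Fin n), i ∉ S →
    reducedCost φ h i ≠ 0

/-- Only finitely many nonzero vectors have to be avoided by the kernel of `φ`. -/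
theorem exists_isGeneric (L : Submodule ℝ (E n)) : ∃ φ : E n →ₗ[ℝ] ℝ, IsGeneric φ L := by
  let ι := {p : Finset (Fin n) × Fin n // IsCompl L (coordSubspace p.1) ∧ p.2 ∉ p.1}
  obtain ⟨φ, hφ⟩ := Module.exists_dual_forall_apply_ne_zero (K := ℝ) (M := E n) (ι := ι)
    (fun p => L.projection (coordSubspace p.1.1) p.2.1 (EuclideanSpace.single p.1.2 1))
    (fun p => projection_single_ne_zero p.2.1 p.2.2)
  exact ⟨φ, fun S h i hi => hφ ⟨(S, i), h, hi⟩⟩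

/-- The signs of the reduced costs, which describe the face of the cube on which `φ` attains its
maxima over slices. -/
noncomputable def optimalPattern (φ : E n →ₗ[ℝ] ℝ) {L : Submodule ℝ (E n)} {S : Finset (Fin n)}
    (h : IsCompl L (coordSubspace S)) : Fin n → SignType :=
  fun i => SignType.sign (reducedCost φ h i)

theorem zeros_optimalPattern {φ : E n →ₗ[ℝ] ℝ} {L : Submodule ℝ (E n)} (hφ : IsGeneric φ L)
    {S : Finset (Fin n)} (h : IsCompl L (coordSubspace S)) : zeros (optimalPattern φ h) = S := by
  ext i
  rw [mem_zeros, optimalPattern, sign_eq_zero_iff]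
  exact ⟨fun h0 => by_contra fun hi => hφ S h i hi h0, reducedCost_eq_zero φ h⟩

/-- Each coordinate with nonzero cost already sits at its favourable bound, so every term of `φ (y -
x)` is nonpositive. Equality would fix all coordinates outside `S`, putting `y - x` in both
complementary subspaces. -/
theorem apply_lt_of_mem_openFace_optimalPattern {φ : E n →ₗ[ℝ] ℝ} {L : Submodule ℝ (E n)}
    (hφ : IsGeneric φ L) {S : Finset (Fin n)} (h : IsCompl L (coordSubspace S)) {x y : E n}
    (hx : x ∈ openFace (optimalPattern φ h)) (hy : y ∈ cube n) (hyx : y - x ∈ L) (hne : y ≠ x) :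
    φ y < φ x := by
  have hterm : ∀ i, (y - x) i * reducedCost φ h i ≤ 0 := by
    intro i
    rcases lt_trichotomy (reducedCost φ h i) 0 with hr | hr | hr
    · have hs : optimalPattern φ h i = -1 := sign_neg hr
      have := (hx i).2 (by rw [hs]; decide)
      have hxi : x i = -1 := by simpa [hs] using this
      exact mul_nonpos_of_nonneg_of_nonpos
        (by rw [PiLp.sub_apply, hxi]; linarith [(hy i).1]) hr.le
    · simp [hr]
    · have hs : optimalPattern φ h i = 1 := sign_pos hr
      have := (hx i).2 (by rw [hs]; decide)
      have hxi : x i = 1 := by simpa [hs] using this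
      exact mul_nonpos_of_nonpos_of_nonneg
        (by rw [PiLp.sub_apply, hxi]; linarith [(hy i).2]) hr.le
  have hsum := apply_eq_sum_reducedCost φ h hyx
  rw [map_sub] at hsum
  have hle : ∑ i, (y - x) i * reducedCost φ h i ≤ 0 := Finset.sum_nonpos fun i _ => hterm i
  refine lt_of_le_of_ne (by linarith) fun heq => hne ?_
  have h0 : ∑ i, (y - x) i * reducedCost φ h i = 0 := by rw [← hsum, heq, sub_self]
  rw [Finset.sum_eq_zero_iff_of_nonpos fun i _ => hterm i] at h0
  have hmem : y - x ∈ coordSubspace S := fun i hi =>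
    (mul_eq_zero.1 (h0 i (Finset.mem_univ i))).resolve_right (hφ S h i hi)
  exact sub_eq_zero.1 (Submodule.disjoint_def.1 h.disjoint _ hyx hmem)

theorem hits_optimalPattern_unique {φ : E n →ₗ[ℝ] ℝ} {L : Submodule ℝ (E n)}
    (hφ : IsGeneric φ L) {S S' : Finset (Fin n)} (h : IsCompl L (coordSubspace S))
    (h' : IsCompl L (coordSubspace S')) {τ : E n} (hτ : τ ∈ hits L (optimalPattern φ h))
    (hτ' : τ ∈ hits L (optimalPattern φ h')) : S = S' := by
  obtain ⟨x, hx, hxτ⟩ := hτ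
  obtain ⟨y, hy, hyτ⟩ := hτ'
  have hyx : y - x ∈ L := by simpa using L.sub_mem hyτ hxτ
  have hxy : x - y ∈ L := by simpa using L.sub_mem hxτ hyτ
  have : x = y := by
    by_contra hne
    exact lt_asymm
      (apply_lt_of_mem_openFace_optimalPattern hφ h hx (openFace_subset_cube _ hy) hyx
        (Ne.symm hne))
      (apply_lt_of_mem_openFace_optimalPattern hφ h' hy (openFace_subset_cube _ hx) hxy hne)
  subst this
  rw [← zeros_optimalPattern hφ h, ← zeros_optimalPattern hφ h', ← facePattern_eq_of_mem hx,
    ← facePattern_eq_of_mem hy]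

/-- The maximisers form a compact exposed subset, and its extreme points are extreme in `s`. -/
theorem exists_isMaxOn_extremePoints (φ : E n →ₗ[ℝ] ℝ) {s : Set (E n)} (hs : IsCompact s)
    (hne : s.Nonempty) : ∃ x ∈ Set.extremePoints ℝ s, IsMaxOn φ s x := by
  let l : StrongDual ℝ (E n) := LinearMap.toContinuousLinearMap φ
  have hexp : IsExposed ℝ s (l.toExposed s) := ContinuousLinearMap.toExposed.isExposed
  obtain ⟨z, hz, hmax⟩ := hs.exists_isMaxOn hne l.continuous.continuousOn
  obtain ⟨x, hx⟩ := (hexp.isCompact hs).extremePoints_nonempty ⟨z, hz, fun y hy => hmax hy⟩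
  exact ⟨x, hexp.isExtreme.extremePoints_subset_extremePoints hx, fun y hy => hx.1.2 y hy⟩

/-- At a maximising vertex no feasible direction increases `φ`; testing the edge directions reads
off the sign of each reduced cost. The hypothesis `hτ` excludes degenerate translations. -/
theorem exists_mem_hits_optimalPattern {φ : E n →ₗ[ℝ] ℝ} {L : Submodule ℝ (E n)}
    (hφ : IsGeneric φ L) {τ : E n} (hne : (sliceBy L τ).Nonempty)
    (hτ : ∀ σ, τ ∈ hits L σ → Codisjoint L (coordSubspace (zeros σ))) :
    ∃ (S : Finset (Fin n)) (h : IsCompl L (coordSubspace S)),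
      τ ∈ hits L (optimalPattern φ h) := by
  obtain ⟨x, hx, hmax⟩ := exists_isMaxOn_extremePoints φ (isCompact_sliceBy L τ) hne
  rw [mem_extremePoints_sliceBy] at hx
  have hface := mem_openFace_facePattern hx.1.1
  have h : IsCompl L (coordSubspace (zeros (facePattern x))) :=
    ⟨hx.2, hτ _ ⟨x, hface, hx.1.2⟩⟩
  refine ⟨_, h, x, ?_, hx.1.2⟩
  have key : ∀ (d : E n), d ∈ L → (∀ i, x i = 1 → d i ≤ 0) → (∀ i, x i = -1 → 0 ≤ d i) →
      φ d ≤ 0 := by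
    intro d hd h1 h2
    have hpos : ∀ᶠ t : ℝ in nhdsWithin 0 (Set.Ioi 0), 0 < t := self_mem_nhdsWithin
    obtain ⟨t, hmem, ht⟩ := ((eventually_add_smul_mem_cube hx.1.1 h1 h2).and hpos).exists
    have hle : φ (x + t • d) ≤ φ x := hmax ⟨hmem, by
      have := L.add_mem hx.1.2 (L.smul_mem t hd)
      rwa [sub_add_eq_add_sub] at this⟩
    rw [map_add, map_smul, smul_eq_mul] at hle
    by_contra hcon
    have := mul_pos ht (not_le.1 hcon)
    linarith
  have hmemL : ∀ i, L.projection _ h (EuclideanSpace.single i 1) ∈ L := fun i =>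
    Submodule.projection_apply_mem h _
  suffices optimalPattern φ h = facePattern x by rwa [this]
  funext i
  by_cases hi : i ∈ zeros (facePattern x)
  · rw [optimalPattern, reducedCost_eq_zero φ h hi, sign_zero, mem_zeros.1 hi]
  have hnz : ∀ j, x j = 1 ∨ x j = -1 → j ∉ zeros (facePattern x) := fun j hj => by
    rw [mem_zeros_facePattern]; tauto
  have hcost := hφ _ h i hi
  have hi' : x i = 1 ∨ x i = -1 := by rw [mem_zeros_facePattern] at hi; tauto
  have hneg : (-1 : ℝ) ≠ 1 := by norm_num
  rcases hi' with hi1 | hi1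
  -- At an upper bound the edge must be followed backwards to stay in the cube.
  · have := key (-(L.projection _ h (EuclideanSpace.single i 1))) (L.neg_mem (hmemL i))
      (fun j hj => by
        rw [PiLp.neg_apply, projection_single_apply h i (hnz j (.inl hj))]
        split_ifs <;> norm_num)
      (fun j hj => by
        have hji : j ≠ i := by rintro rfl; exact hneg (hj.symm.trans hi1)
        rw [PiLp.neg_apply, projection_single_apply h i (hnz j (.inr hj))]
        simp [hji])
    rw [map_neg] at this
    have hpos : 0 < reducedCost φ h i :=
      lt_of_le_of_ne (by simpa [reducedCost] using this) hcost.symm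
    rw [optimalPattern, sign_pos hpos]
    simp [facePattern, hi1]
  · have := key (L.projection _ h (EuclideanSpace.single i 1)) (hmemL i)
      (fun j hj => by
        have hji : j ≠ i := by rintro rfl; exact hneg (hi1.symm.trans hj)
        rw [projection_single_apply h i (hnz j (.inl hj))]
        simp [hji])
      (fun j hj => by
        rw [projection_single_apply h i (hnz j (.inr hj))]
        split_ifs <;> norm_num)
    have hlt : reducedCost φ h i < 0 := lt_of_le_of_ne this hcost
    rw [optimalPattern, sign_neg hlt]
    simp [facePattern, hi1, hneg]

/-! ### Measurability of projected sets -/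

theorem isSigmaCompact_inter {X : Type*} [PseudoEMetricSpace X] [SigmaCompactSpace X]
    {C U : Set X} (hC : IsClosed C) (hU : IsOpen U) : IsSigmaCompact (C ∩ U) := by
  obtain ⟨F, hF, -, rfl, -⟩ := hU.exists_iUnion_isClosed
  rw [Set.inter_iUnion]
  exact isSigmaCompact_iUnion _ fun m =>
    isSigmaCompact_univ.of_isClosed_subset (hC.inter (hF m)) (Set.subset_univ _)

theorem _root_.IsSigmaCompact.measurableSet {X : Type*} [TopologicalSpace X] [T2Space X]
    [MeasurableSpace X] [BorelSpace X] {s : Set X} (hs : IsSigmaCompact s) : MeasurableSet s := by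
  obtain ⟨K, hK, rfl⟩ := hs
  exact MeasurableSet.iUnion fun m => (hK m).measurableSet

/-- Continuous images of Borel sets need not be Borel, but σ-compactness passes to images. Every
existential set below is written as such an image. -/
theorem measurableSet_image_inter {X Y : Type*} [PseudoEMetricSpace X] [SigmaCompactSpace X]
    [TopologicalSpace Y] [T2Space Y] [MeasurableSpace Y] [BorelSpace Y] {f : X → Y}
    (hf : Continuous f) {C U : Set X} (hC : IsClosed C) (hU : IsOpen U) :
    MeasurableSet (f '' (C ∩ U)) :=
  ((isSigmaCompact_inter hC hU).image hf).measurableSet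

theorem exists_openFace_eq (σ : Fin n → SignType) :
    ∃ C U : Set (E n), IsClosed C ∧ IsOpen U ∧ openFace σ = C ∩ U := by
  refine ⟨⋂ i, {x : E n | σ i ≠ 0 → x i = (σ i : ℝ)}, ⋂ i, {x : E n | σ i = 0 → |x i| < 1},
    isClosed_iInter fun i => ?_, isOpen_iInter_of_finite fun i => ?_, ?_⟩
  · by_cases h : σ i = 0
    · simp [h]
    · simp only [ne_eq, h, not_false_eq_true, true_imp_iff]
      exact isClosed_eq (by fun_prop) continuous_const
  · by_cases h : σ i = 0
    · simp only [h, true_imp_iff]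
      exact isOpen_lt (by fun_prop) continuous_const
    · simp [h]
  · ext x
    simp only [openFace, Set.mem_ofPred_eq, Set.mem_inter_iff, Set.mem_iInter]
    rw [← forall_and]
    exact forall_congr' fun i => and_comm

theorem measurableSet_setOf_exists_sub_mem (L : Submodule ℝ (E n)) {C U : Set (E n)}
    (hC : IsClosed C) (hU : IsOpen U) :
    MeasurableSet {τ : E n | ∃ x ∈ C ∩ U, x - τ ∈ L} := by
  have hCl : IsClosed {p : E n × E n | p.2 ∈ C ∧ p.2 - p.1 ∈ L} :=
    (hC.preimage continuous_snd).inter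
      ((Submodule.closed_of_finiteDimensional L).preimage
        (by fun_prop : Continuous fun p : E n × E n => p.2 - p.1))
  have := measurableSet_image_inter continuous_fst hCl (hU.preimage continuous_snd)
  convert this using 1
  ext τ
  constructor
  · rintro ⟨x, hx, h⟩
    exact ⟨(τ, x), ⟨⟨hx.1, h⟩, hx.2⟩, rfl⟩
  · rintro ⟨⟨τ', x⟩, ⟨⟨h1, h2⟩, h3⟩, rfl⟩
    exact ⟨x, ⟨h1, h3⟩, h2⟩

theorem measurableSet_hits (L : Submodule ℝ (E n)) (σ : Fin n → SignType) :
    MeasurableSet (hits L σ) := by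
  obtain ⟨C, U, hC, hU, h⟩ := exists_openFace_eq σ
  rw [hits, h]
  exact measurableSet_setOf_exists_sub_mem L hC hU

theorem measurableSet_sliceBy_nonempty (L : Submodule ℝ (E n)) :
    MeasurableSet {τ : E n | (sliceBy L τ).Nonempty} := by
  have := measurableSet_setOf_exists_sub_mem L (isClosed_cube n) isOpen_univ
  rw [Set.inter_univ] at this
  exact this

/-! ### Projected faces: volumes, counting and tiling -/

/-- The points of the normal space of `L` whose translates of `L` meet the open face of `σ`. -/
def normalHits (L : Submodule ℝ (E n)) (σ : Fin n → SignType) : Set (Lᗮ : Submodule ℝ (E n)) :=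
  Subtype.val ⁻¹' hits L σ

theorem measurableSet_normalHits (L : Submodule ℝ (E n)) (σ : Fin n → SignType) :
    MeasurableSet (normalHits L σ) :=
  measurable_subtype_coe (measurableSet_hits L σ)

theorem orthogonalProjection_eq_of_sub_mem {L : Submodule ℝ (E n)} {x : E n}
    {τ : (Lᗮ : Submodule ℝ (E n))} (h : x - τ ∈ L) : Lᗮ.orthogonalProjectionOnto x = τ := by
  apply Subtype.ext
  rw [← Submodule.starProjection_apply]
  refine Submodule.eq_starProjection_of_mem_of_inner_eq_zero τ.2 fun w hw => ?_
  exact hw _ h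

theorem sub_orthogonalProjection_mem (L : Submodule ℝ (E n)) (x : E n) :
    x - Lᗮ.orthogonalProjectionOnto x ∈ L := by
  have := Submodule.sub_starProjection_mem_orthogonal (K := Lᗮ) x
  rwa [Submodule.orthogonal_orthogonal] at this

/-- The projected face lies in a translate of the projected coordinate subspace, which is proper in
`Lᗮ`. -/
theorem volume_normalHits_of_not_codisjoint {L : Submodule ℝ (E n)} {σ : Fin n → SignType}
    (h : ¬ Codisjoint L (coordSubspace (zeros σ))) : volume (normalHits L σ) = 0 := by
  rcases (normalHits L σ).eq_empty_or_nonempty with he | ⟨τ₀, x₀, hx₀, hxτ₀⟩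
  · rw [he, measure_empty]
  let W : Submodule ℝ (Lᗮ : Submodule ℝ (E n)) :=
    (coordSubspace (zeros σ)).map Lᗮ.orthogonalProjectionOnto.toLinearMap
  have hW : W ≠ ⊤ := by
    intro htop
    apply h
    rw [codisjoint_iff, eq_top_iff]
    intro x _
    obtain ⟨f, hf, hfx⟩ : Lᗮ.orthogonalProjectionOnto x ∈ W := htop ▸ Submodule.mem_top
    have h0 : Lᗮ.orthogonalProjectionOnto (x - f) = 0 := by
      rw [map_sub, sub_eq_zero]; exact hfx.symm
    have := sub_orthogonalProjection_mem L (x - f)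
    rw [h0] at this
    rw [← sub_add_cancel x f]
    exact Submodule.add_mem_sup (by simpa using this) hf
  refine measure_mono_null (t := (AffineSubspace.mk' τ₀ W : Set _)) ?_
    (Measure.addHaar_affineSubspace volume _ fun htop => hW ?_)
  · rintro τ ⟨x, hx, hxτ⟩
    rw [SetLike.mem_coe, AffineSubspace.mem_mk', vsub_eq_sub]
    refine ⟨x - x₀, openFace_sub_mem hx hx₀, ?_⟩
    have h1 := orthogonalProjection_eq_of_sub_mem hxτ
    have h2 := orthogonalProjection_eq_of_sub_mem hxτ₀
    rw [map_sub]
    exact congrArg₂ (· - ·) h1 h2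
  · rw [← AffineSubspace.direction_mk' τ₀ W, htop, AffineSubspace.direction_top]

/-- The two faces differ by the translation `σ' - σ`, so their projections differ by its projection.
-/
theorem volume_normalHits_congr (L : Submodule ℝ (E n)) {σ σ' : Fin n → SignType}
    (h : zeros σ = zeros σ') : volume (normalHits L σ) = volume (normalHits L σ') := by
  have key : ∀ {σ σ' : Fin n → SignType}, zeros σ = zeros σ' → ∀ x ∈ openFace σ,
      x + WithLp.toLp 2 (fun i => (σ' i : ℝ) - (σ i : ℝ)) ∈ openFace σ' := by
    intro σ σ' h x hx i
    have hi : σ i = 0 ↔ σ' i = 0 := by rw [← mem_zeros, ← mem_zeros, h]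
    constructor
    · intro h0
      have := (hx i).1 (hi.2 h0)
      simpa [h0, hi.2 h0] using this
    · intro h0
      have := (hx i).2 (fun h => h0 (hi.1 h))
      simp [this]
  set a : E n := WithLp.toLp 2 (fun i => (σ' i : ℝ) - (σ i : ℝ)) with ha
  have hna : -a = WithLp.toLp 2 (fun i => (σ i : ℝ) - (σ' i : ℝ)) := by
    ext i; simp [ha]
  rw [← measure_preimage_add_right volume (Lᗮ.orthogonalProjectionOnto a) (normalHits L σ')]
  congr 1
  have hmem := sub_orthogonalProjection_mem L a
  ext τ
  constructor
  · rintro ⟨x, hx, hxτ⟩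
    refine ⟨x + a, key h x hx, ?_⟩
    have := L.add_mem hxτ hmem
    rw [Submodule.coe_add]
    convert this using 1
    abel
  · rintro ⟨x, hx, hxτ⟩
    refine ⟨x + -a, hna ▸ key h.symm x hx, ?_⟩
    have := L.sub_mem hxτ hmem
    rw [Submodule.coe_add] at this
    convert this using 1
    abel

/-- The coordinate subspace of `S` is the space of functions on `S`. -/
noncomputable def coordSubspaceEquiv (S : Finset (Fin n)) : coordSubspace S ≃ₗ[ℝ] (S → ℝ) where
  toFun d := fun i => (d : E n) i
  map_add' _ _ := rfl
  map_smul' _ _ := rfl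
  invFun f := ⟨WithLp.toLp 2 fun i => if h : i ∈ S then f ⟨i, h⟩ else 0,
    fun i hi => by simp [hi]⟩
  left_inv d := by
    ext i
    by_cases h : i ∈ S
    · simp [h]
    · simp [h, d.2 i h]
  right_inv f := by
    funext i
    simp

theorem card_zeros_eq (S : Finset (Fin n)) :
    (Finset.univ.filter fun σ : Fin n → SignType => zeros σ = S).card = 2 ^ (n - S.card) := by
  have : (Finset.univ.filter fun σ : Fin n → SignType => zeros σ = S) =
      Fintype.piFinset fun i => if i ∈ S then {0} else {1, -1} := by
    ext σ
    simp only [Finset.mem_filter, Finset.mem_univ, true_and, Fintype.mem_piFinset,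
      Finset.ext_iff, mem_zeros]
    refine forall_congr' fun i => ?_
    by_cases hi : i ∈ S
    · simp [hi]
    · simp only [hi, iff_false, if_false]
      generalize σ i = s
      revert s
      decide
  rw [this, Fintype.card_piFinset]
  have h2 : ∀ i, (if i ∈ S then ({0} : Finset SignType) else {1, -1}).card =
      if i ∈ S then 1 else 2 := by
    intro i; split_ifs <;> rfl
  simp only [h2]
  rw [Finset.prod_ite]
  simp only [Finset.prod_const_one, one_mul, Finset.prod_const]
  congr 1
  have hc : (Finset.univ.filter fun i => i ∉ S) = Sᶜ := by ext i; simp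
  rw [hc, Finset.card_compl, Fintype.card_fin]

theorem card_zeros_eq_of_isCompl {L : Submodule ℝ (E n)} {S : Finset (Fin n)}
    (h : IsCompl L (coordSubspace S)) :
    (Finset.univ.filter fun σ : Fin n → SignType => zeros σ = S).card =
      2 ^ Module.finrank ℝ L := by
  rw [card_zeros_eq]
  have h1 := Submodule.finrank_add_eq_of_isCompl h
  rw [(coordSubspaceEquiv S).finrank_eq, Module.finrank_fintype_fun_eq_card, Fintype.card_coe,
    finrank_euclideanSpace_fin] at h1
  congr 1
  omega

open Classical in
/-- The sum, over complementary coordinate subspaces, of the volumes of the projected optimal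
faces is the volume of the projected cube. -/
theorem sum_volume_normalHits_optimalPattern {φ : E n →ₗ[ℝ] ℝ} {L : Submodule ℝ (E n)}
    (hφ : IsGeneric φ L) :
    ∑ S : Finset (Fin n), (if h : IsCompl L (coordSubspace S) then
        volume (normalHits L (optimalPattern φ h)) else 0) =
      volume {τ : (Lᗮ : Submodule ℝ (E n)) | (sliceBy L (τ : E n)).Nonempty} := by
  let A : Finset (Fin n) → Set (Lᗮ : Submodule ℝ (E n)) := fun S =>
    if h : IsCompl L (coordSubspace S) then normalHits L (optimalPattern φ h) else ∅
  have hA : ∀ S τ, τ ∈ A S ↔ ∃ h : IsCompl L (coordSubspace S),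
      (τ : E n) ∈ hits L (optimalPattern φ h) := by
    intro S τ
    by_cases h : IsCompl L (coordSubspace S)
    · simp [A, h, normalHits]
    · simp [A, h]
  have hvol : ∀ S, (if h : IsCompl L (coordSubspace S) then
      volume (normalHits L (optimalPattern φ h)) else 0) = volume (A S) := by
    intro S
    by_cases h : IsCompl L (coordSubspace S) <;> simp [A, h]
  have hmeas : ∀ S, MeasurableSet (A S) := by
    intro S
    by_cases h : IsCompl L (coordSubspace S)
    · simpa [A, h] using measurableSet_normalHits L _
    · simp [A, h]
  have hdisj : Pairwise (Function.onFun Disjoint A) := by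
    intro S S' hne
    rw [Function.onFun, Set.disjoint_left]
    intro τ h1 h2
    obtain ⟨h, h1⟩ := (hA _ _).1 h1
    obtain ⟨h', h2⟩ := (hA _ _).1 h2
    exact hne (hits_optimalPattern_unique hφ h h' h1 h2)
  rw [Finset.sum_congr rfl fun S _ => hvol S, ← tsum_fintype (L := .unconditional _),
    ← measure_iUnion hdisj hmeas]
  apply measure_congr
  -- Degenerate translations lie in finitely many null projections.
  have hae : ∀ᵐ τ : (Lᗮ : Submodule ℝ (E n)), ∀ σ, (τ : E n) ∈ hits L σ →
      Codisjoint L (coordSubspace (zeros σ)) := by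
    rw [ae_all_iff]
    intro σ
    by_cases h : Codisjoint L (coordSubspace (zeros σ))
    · simp [h]
    · have := volume_normalHits_of_not_codisjoint h
      filter_upwards [measure_eq_zero_iff_ae_notMem.1 this] with τ hτ hτ'
      exact absurd hτ' hτ
  filter_upwards [hae] with τ hτ
  apply propext
  change τ ∈ (⋃ S, A S) ↔ (sliceBy L (τ : E n)).Nonempty
  rw [Set.mem_iUnion]
  constructor
  · rintro ⟨S, hS⟩
    obtain ⟨h, x, hx, hxτ⟩ := (hA _ _).1 hS
    exact ⟨x, openFace_subset_cube _ hx, hxτ⟩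
  · intro hne
    obtain ⟨S, h, hS⟩ := exists_mem_hits_optimalPattern hφ hne hτ
    exact ⟨S, (hA _ _).2 ⟨h, hS⟩⟩

open Classical in
theorem lintegral_encard_extremePoints (L : Submodule ℝ (E n)) :
    ∫⁻ τ : (Lᗮ : Submodule ℝ (E n)),
        ((Set.extremePoints ℝ (sliceBy L (τ : E n))).encard : ℝ≥0∞) =
      2 ^ Module.finrank ℝ L *
        volume {τ : (Lᗮ : Submodule ℝ (E n)) | (sliceBy L (τ : E n)).Nonempty} := by
  obtain ⟨φ, hφ⟩ := exists_isGeneric L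
  let g : Finset (Fin n) → ℝ≥0∞ := fun S => if h : IsCompl L (coordSubspace S) then
        volume (normalHits L (optimalPattern φ h)) else 0
  let B : (Fin n → SignType) → Set (Lᗮ : Submodule ℝ (E n)) := fun σ =>
    {τ | Disjoint L (coordSubspace (zeros σ)) ∧ (τ : E n) ∈ hits L σ}
  have hB : ∀ σ, Disjoint L (coordSubspace (zeros σ)) → B σ = normalHits L σ := fun σ h => by
    ext τ; simp [B, h, normalHits]
  have hB' : ∀ σ, ¬ Disjoint L (coordSubspace (zeros σ)) → B σ = ∅ := fun σ h => by
    ext τ; simp [B, h]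
  have hmeas : ∀ σ, MeasurableSet (B σ) := by
    intro σ
    by_cases h : Disjoint L (coordSubspace (zeros σ))
    · rw [hB σ h]; exact measurableSet_normalHits L σ
    · rw [hB' σ h]; exact MeasurableSet.empty
  have hvol : ∀ σ, volume (B σ) = g (zeros σ) := by
    intro σ
    by_cases h : Disjoint L (coordSubspace (zeros σ))
    · rw [hB σ h]
      by_cases h' : Codisjoint L (coordSubspace (zeros σ))
      · have hc : IsCompl L (coordSubspace (zeros σ)) := ⟨h, h'⟩
        simp only [g, hc, dif_pos]
        exact volume_normalHits_congr L (zeros_optimalPattern hφ hc).symm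
      · have hc : ¬ IsCompl L (coordSubspace (zeros σ)) := fun hc => h' hc.codisjoint
        simp only [g, hc, dif_neg, not_false_eq_true]
        exact volume_normalHits_of_not_codisjoint h'
    · have hc : ¬ IsCompl L (coordSubspace (zeros σ)) := fun hc => h hc.disjoint
      simp [hB' σ h, g, hc]
  calc ∫⁻ τ : (Lᗮ : Submodule ℝ (E n)),
        ((Set.extremePoints ℝ (sliceBy L (τ : E n))).encard : ℝ≥0∞)
      = ∫⁻ τ : (Lᗮ : Submodule ℝ (E n)), ∑ σ, (B σ).indicator 1 τ := by
        refine lintegral_congr fun τ => ?_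
        rw [encard_extremePoints_sliceBy]
        refine Finset.sum_congr rfl fun σ _ => ?_
        simp only [Set.indicator_apply, Pi.one_apply]
        rfl
    _ = ∑ σ, g (zeros σ) := by
        rw [lintegral_finsetSum _ fun σ _ => measurable_one.indicator (hmeas σ)]
        exact Finset.sum_congr rfl fun σ _ => by rw [lintegral_indicator_one (hmeas σ), hvol]
    _ = ∑ S : Finset (Fin n), ∑ σ with zeros σ = S, g (zeros σ) :=
        (Finset.sum_fiberwise _ _ _).symm
    _ = ∑ S : Finset (Fin n), 2 ^ Module.finrank ℝ L * g S := by
        refine Finset.sum_congr rfl fun S _ => ?_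
        rw [Finset.sum_congr rfl fun σ hσ => by rw [(Finset.mem_filter.1 hσ).2],
          Finset.sum_const, nsmul_eq_mul]
        -- The size of the fibre is needed only for complementary `S`; otherwise `g S = 0`.
        by_cases h : IsCompl L (coordSubspace S)
        · rw [card_zeros_eq_of_isCompl h]; simp
        · simp [g, h]
    _ = _ := by
        rw [← Finset.mul_sum]
        exact congrArg _ (sum_volume_normalHits_optimalPattern hφ)

/-! ### Measurable dependence on the orientation -/

variable {k : ℕ}

theorem orthogonalProjectionOnto_coe_add {L : Submodule ℝ (E n)} (g : (Lᗮ : Submodule ℝ (E n)))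
    (x : E n) : Lᗮ.orthogonalProjectionOnto (g + x) = g + Lᗮ.orthogonalProjectionOnto x := by
  rw [map_add, Submodule.orthogonalProjectionOnto_mem_subspace_eq_self]

/-- The part of Lebesgue measure within distance one of the normal space of `L` projects onto a
multiple of the Lebesgue measure of the normal space. -/
theorem exists_volume_slab_eq (L : Submodule ℝ (E n)) :
    ∃ c : ℝ≥0∞, c ≠ 0 ∧ c ≠ ∞ ∧ ∀ B : Set (Lᗮ : Submodule ℝ (E n)), MeasurableSet B →
      volume {x : E n | Lᗮ.orthogonalProjectionOnto x ∈ B ∧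
        ‖x - Lᗮ.orthogonalProjectionOnto x‖ ≤ 1} = c * volume B := by
  let P := Lᗮ.orthogonalProjectionOnto
  let D : E n → E n := fun x => x - P x
  have hP : Continuous P := P.continuous
  have hD : Continuous D := by
    have : Continuous fun x => (P x : E n) := continuous_subtype_val.comp hP
    exact continuous_id.sub this
  have hDadd : ∀ (g : (Lᗮ : Submodule ℝ (E n))) (x : E n), D (g + x) = D x := by
    intro g x
    change (g : E n) + x - (P (g + x) : E n) = x - P x
    rw [show P (g + x) = g + P x from orthogonalProjectionOnto_coe_add g x, Submodule.coe_add]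
    abel
  let ν : Measure (Lᗮ : Submodule ℝ (E n)) := (volume.restrict {x : E n | ‖D x‖ ≤ 1}).map P
  have hν : ∀ B : Set (Lᗮ : Submodule ℝ (E n)), MeasurableSet B →
      ν B = volume {x : E n | P x ∈ B ∧ ‖D x‖ ≤ 1} := by
    intro B hB
    rw [Measure.map_apply hP.measurable hB, Measure.restrict_apply (hP.measurable hB)]
    rfl
  have h1 : IsFiniteMeasureOnCompacts ν := ⟨by
    intro K hK
    obtain ⟨R, hR⟩ := hK.isBounded.subset_closedBall 0
    rw [hν K hK.measurableSet]
    refine lt_of_le_of_lt (measure_mono (t := Metric.closedBall 0 (R + 1)) ?_)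
      measure_closedBall_lt_top
    rintro x ⟨hx, hx'⟩
    have h2 := hR hx
    rw [mem_closedBall_zero_iff] at h2 ⊢
    calc ‖x‖ = ‖(P x : E n) + D x‖ := by congr 1; exact (add_sub_cancel _ _).symm
      _ ≤ ‖(P x : E n)‖ + ‖D x‖ := norm_add_le _ _
      _ ≤ R + 1 := add_le_add h2 hx'⟩
  have h2 : ν.IsAddLeftInvariant := ⟨by
    intro g
    ext B hB
    have hg : Measurable fun τ : (Lᗮ : Submodule ℝ (E n)) => g + τ := measurable_const_add g
    rw [Measure.map_apply hg hB, hν _ (hg hB), hν _ hB,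
      ← measure_preimage_add volume (g : E n) {x : E n | P x ∈ B ∧ ‖D x‖ ≤ 1}]
    congr 1
    ext x
    have hx : P (g + x) = g + P x := orthogonalProjectionOnto_coe_add g x
    simp only [Set.mem_preimage, Set.mem_ofPred_eq, hDadd, hx]⟩
  have h3 : ν.IsOpenPosMeasure := ⟨by
    intro U hU hne
    obtain ⟨τ, hτ⟩ := hne
    rw [hν U hU.measurableSet]
    have hopen : IsOpen {x : E n | P x ∈ U ∧ ‖D x‖ < 1} :=
      (hU.preimage hP).inter (isOpen_lt hD.norm continuous_const)
    have hPτ : P τ = τ := Submodule.orthogonalProjectionOnto_mem_subspace_eq_self τ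
    have hmem : (τ : E n) ∈ {x : E n | P x ∈ U ∧ ‖D x‖ < 1} := by
      refine ⟨by rw [hPτ]; exact hτ, ?_⟩
      simp only [D, hPτ, sub_self, norm_zero, zero_lt_one]
    have hne : Set.Nonempty {x : E n | P x ∈ U ∧ ‖D x‖ < 1} := ⟨τ, hmem⟩
    have hpos := hopen.measure_pos volume hne
    have hsub : {x : E n | P x ∈ U ∧ ‖D x‖ < 1} ⊆ {x : E n | P x ∈ U ∧ ‖D x‖ ≤ 1} :=
      fun x hx => ⟨hx.1, hx.2.le⟩
    exact (hpos.trans_le (measure_mono hsub)).ne'⟩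
  have h4 : ν.IsAddHaarMeasure := { }
  -- Uniqueness of Haar measure makes `ν` a multiple of Lebesgue measure.
  refine ⟨ν.addHaarScalarFactor volume, ?_, ENNReal.coe_ne_top, fun B hB => ?_⟩
  · rw [Ne, ENNReal.coe_eq_zero]
    exact (Measure.addHaarScalarFactor_pos_of_isAddHaarMeasure ν volume).ne'
  · have := Measure.isAddLeftInvariant_eq_smul ν volume
    have h5 : ν B = (ν.addHaarScalarFactor volume • volume) B := congrArg (fun m => m B) this
    exact (hν B hB).symm.trans (h5.trans (Measure.coe_nnreal_smul_apply _ _ _))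

theorem measurableSet_translations (v : Orientation n k) : MeasurableSet (translations v) := by
  have := measurable_subtype_coe (p := (· ∈ (direction v)ᗮ))
    (measurableSet_sliceBy_nonempty (direction v))
  simp only [translations, slice_eq_sliceBy]
  exact this

theorem volume_translations_ne_zero (v : Orientation n k) : volume (translations v) ≠ 0 := by
  have : Metric.ball (0 : ((direction v)ᗮ : Submodule ℝ (E n))) 1 ⊆ translations v := by
    intro τ hτ
    rw [mem_ball_zero_iff] at hτ
    change (slice v (τ : E n)).Nonempty
    rw [slice_eq_sliceBy]
    refine ⟨τ, fun i => ?_, by simp⟩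
    rw [Set.mem_Icc, ← abs_le]
    exact (PiLp.norm_apply_le (τ : E n) i).trans hτ.le
  exact ((Metric.measure_ball_pos volume 0 one_pos).trans_le (measure_mono this)).ne'

theorem volume_translations_ne_top (v : Orientation n k) : volume (translations v) ≠ ∞ := by
  have : translations v ⊆ (direction v)ᗮ.orthogonalProjectionOnto '' cube n := by
    intro τ hτ
    change (slice v (τ : E n)).Nonempty at hτ
    rw [slice_eq_sliceBy] at hτ
    obtain ⟨x, hx, hxτ⟩ := hτ
    exact ⟨x, hx, orthogonalProjection_eq_of_sub_mem hxτ⟩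
  exact ((measure_mono this).trans_lt
    ((isCompact_cube n).image (ContinuousLinearMap.continuous _)).measure_lt_top).ne

instance isProbabilityMeasure_translationLaw (v : Orientation n k) :
    IsProbabilityMeasure (translationLaw v) := by
  have := cond_isProbabilityMeasure_of_finite (volume_translations_ne_zero v)
    (volume_translations_ne_top v)
  exact Measure.isProbabilityMeasure_map measurable_subtype_coe.aemeasurable

/-- The projection of a point onto the normal space of an orientation. -/
noncomputable def normalPart (v : Orientation n k) (x : E n) : E n :=
  (direction v)ᗮ.orthogonalProjectionOnto x

theorem mem_direction_iff {v : Orientation n k} {x : E n} :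
    x ∈ direction v ↔ ∃ c : Fin k → ℝ, ∑ j, c j • (v j : E n) = x :=
  Submodule.mem_span_range_iff_exists_fun ℝ

/-- The projection can jump where the rank of `v` drops. The preimage of a closed set is instead the
shadow of a closed set of triples `(v, x, c)`, with `c` the coefficients of the part of `x` along
`v`. -/
theorem measurable_normalPart :
    Measurable fun p : Orientation n k × E n => normalPart p.1 p.2 := by
  refine measurable_of_isClosed fun K hK => ?_
  let f : (Orientation n k × E n) × (Fin k → ℝ) → E n :=
    fun q => q.1.2 - ∑ j, q.2 j • (q.1.1 j : E n)
  have hf : Continuous f := by fun_prop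
  have hC : IsClosed ({q | ∀ j, inner ℝ (q.1.1 j : E n) (f q) = 0} ∩ f ⁻¹' K) := by
    refine IsClosed.inter ?_ (hK.preimage hf)
    have : {q | ∀ j, inner ℝ (q.1.1 j : E n) (f q) = 0} =
      ⋂ j, {q | inner ℝ (q.1.1 j : E n) (f q) = 0} := by ext; simp
    rw [this]
    refine isClosed_iInter fun j => isClosed_eq ?_ continuous_const
    exact Continuous.inner (by fun_prop) hf
  convert measurableSet_image_inter continuous_fst hC isOpen_univ using 1
  rw [Set.inter_univ]
  ext ⟨v, x⟩
  constructor
  · intro h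
    obtain ⟨c, hc⟩ := mem_direction_iff.1 (sub_orthogonalProjection_mem (direction v) x)
    have hfx : f ((v, x), c) = normalPart v x := by
      simp only [f, hc, normalPart, sub_sub_cancel]
    refine ⟨((v, x), c), ⟨fun j => ?_, ?_⟩, rfl⟩
    · rw [hfx]
      exact (Submodule.mem_orthogonal _ _).1 (Submodule.coe_mem _) _
        (Submodule.subset_span ⟨j, rfl⟩)
    · rw [Set.mem_preimage, hfx]
      exact h
  · rintro ⟨⟨⟨v', x'⟩, c⟩, ⟨h1, h2⟩, heq⟩
    obtain ⟨rfl, rfl⟩ := Prod.mk.inj heq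
    have hmem : f ((v', x'), c) ∈ (direction v')ᗮ := by
      rw [direction, Submodule.mem_orthogonal]
      intro u hu
      induction hu using Submodule.span_induction with
      | mem u hu => obtain ⟨j, rfl⟩ := hu; exact h1 j
      | zero => simp
      | add a b _ _ ha hb => rw [inner_add_left, ha, hb, add_zero]
      | smul r a _ ha => rw [inner_smul_left, ha, mul_zero]
    have h3 : normalPart v' x' = f ((v', x'), c) :=
      congrArg Subtype.val (orthogonalProjection_eq_of_sub_mem (τ := ⟨_, hmem⟩)
        (mem_direction_iff.2 ⟨c, by simp [f]⟩))
    rw [Set.mem_preimage, h3]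
    exact h2

theorem measurableSet_setOf_exists_sub_mem_direction {C U : Set (E n)} (hC : IsClosed C)
    (hU : IsOpen U) :
    MeasurableSet {p : Orientation n k × E n | ∃ x ∈ C ∩ U, x - p.2 ∈ direction p.1} := by
  let f : (Orientation n k × E n) × (Fin k → ℝ) → E n :=
    fun q => q.1.2 + ∑ j, q.2 j • (q.1.1 j : E n)
  have hf : Continuous f := by fun_prop
  convert measurableSet_image_inter continuous_fst (hC.preimage hf) (hU.preimage hf) using 1
  ext ⟨v, τ⟩
  constructor
  · rintro ⟨x, hx, h⟩
    obtain ⟨c, hc⟩ := mem_direction_iff.1 h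
    have : f ((v, τ), c) = x := by simp only [f, hc, add_sub_cancel]
    exact ⟨((v, τ), c), ⟨by rw [Set.mem_preimage, this]; exact hx.1,
      by rw [Set.mem_preimage, this]; exact hx.2⟩, rfl⟩
  · rintro ⟨⟨⟨v', x'⟩, c⟩, ⟨h1, h2⟩, heq⟩
    obtain ⟨rfl, rfl⟩ := Prod.mk.inj heq
    exact ⟨_, ⟨h1, h2⟩, mem_direction_iff.2 ⟨c, by simp [f]⟩⟩

theorem measurableSet_slice_nonempty :
    MeasurableSet {p : Orientation n k × E n | (slice p.1 p.2).Nonempty} := by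
  have := measurableSet_setOf_exists_sub_mem_direction (k := k) (isClosed_cube n) isOpen_univ
  rw [Set.inter_univ] at this
  simp only [slice_eq_sliceBy]
  exact this

theorem measurableSet_disjoint_direction (S : Finset (Fin n)) :
    MeasurableSet {v : Orientation n k | Disjoint (direction v) (coordSubspace S)} := by
  rw [← MeasurableSet.compl_iff]
  let f : Orientation n k × (Fin k → ℝ) → E n := fun q => ∑ j, q.2 j • (q.1 j : E n)
  have hf : Continuous f := by fun_prop
  have hC : IsClosed (coordSubspace S : Set (E n)) := Submodule.closed_of_finiteDimensional _
  have hU : IsOpen {x : E n | x ≠ 0} := isOpen_ne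
  convert measurableSet_image_inter continuous_fst (hC.preimage hf) (hU.preimage hf) using 1
  ext v
  rw [Set.mem_compl_iff, Set.mem_ofPred_eq, Submodule.disjoint_def]
  push Not
  constructor
  · rintro ⟨x, hx, hxS, hx0⟩
    obtain ⟨c, rfl⟩ := mem_direction_iff.1 hx
    exact ⟨(v, c), ⟨hxS, hx0⟩, rfl⟩
  · rintro ⟨⟨v', c⟩, ⟨h1, h2⟩, rfl⟩
    exact ⟨_, mem_direction_iff.2 ⟨c, rfl⟩, h1, h2⟩

open Classical in
theorem measurable_vertexCount : Measurable (vertexCount (n := n) (k := k)) := by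
  have : vertexCount (n := n) (k := k) = fun p => ∑ σ : Fin n → SignType,
      if Disjoint (direction p.1) (coordSubspace (zeros σ)) ∧ p.2 ∈ hits (direction p.1) σ
        then 1 else 0 := by
    funext p
    rw [vertexCount, slice_eq_sliceBy, encard_extremePoints_sliceBy]
  rw [this]
  refine Finset.measurable_fun_sum _ fun σ _ =>
    Measurable.ite (MeasurableSet.inter ?_ ?_) measurable_const measurable_const
  · exact measurable_fst (measurableSet_disjoint_direction (zeros σ))
  · obtain ⟨C, U, hC, hU, h⟩ := exists_openFace_eq σ
    simp only [hits, h]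
    exact measurableSet_setOf_exists_sub_mem_direction hC hU

/-- The points within distance one of the normal space of an orientation whose projections are
translations for which the flat meets the cube. -/
def normalSlab (v : Orientation n k) : Set (E n) :=
  {x | (slice v (normalPart v x)).Nonempty ∧ ‖x - normalPart v x‖ ≤ 1}

theorem measurableSet_normalSlab :
    MeasurableSet {p : Orientation n k × E n | p.2 ∈ normalSlab p.1} := by
  refine MeasurableSet.inter ?_ ?_
  · exact (measurable_fst.prodMk measurable_normalPart) measurableSet_slice_nonempty
  · exact measurableSet_le (measurable_snd.sub measurable_normalPart).norm measurable_const

theorem measurable_normalPart_right (v : Orientation n k) : Measurable (normalPart v) :=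
  Measurable.of_uncurry_left (f := normalPart) measurable_normalPart

theorem measurableSet_normalSlab_right (v : Orientation n k) : MeasurableSet (normalSlab v) := by
  have := measurable_prodMk_left (x := v) (measurableSet_normalSlab (n := n) (k := k))
  exact this

/-- The constant of `exists_volume_slab_eq` cancels in the conditioning. The right side uses one
fixed measure, so its dependence on `v` is through measurable sets and maps only. -/
theorem translationLaw_eq_map_normalPart (v : Orientation n k) :
    translationLaw v = (cond volume (normalSlab v)).map (normalPart v) := by
  obtain ⟨c, hc0, hc, h⟩ := exists_volume_slab_eq (direction v)
  have hm := measurable_normalPart_right v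
  have hslab := measurableSet_normalSlab_right v
  ext B hB
  have hB' : MeasurableSet (Subtype.val ⁻¹' B : Set ((direction v)ᗮ : Submodule ℝ (E n))) :=
    measurable_subtype_coe hB
  rw [translationLaw, Measure.map_apply measurable_subtype_coe hB, Measure.map_apply hm hB,
    cond_apply (measurableSet_translations v), cond_apply hslab]
  have h1 : volume (normalSlab v) = c * volume (translations v) :=
    h _ (measurableSet_translations v)
  have h2 : volume (normalSlab v ∩ normalPart v ⁻¹' B) =
      c * volume (translations v ∩ Subtype.val ⁻¹' B) := by
    rw [← h _ ((measurableSet_translations v).inter hB')]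
    congr 1
    ext x
    constructor
    · rintro ⟨⟨h1, h2⟩, h3⟩
      exact ⟨⟨h1, h3⟩, h2⟩
    · rintro ⟨⟨h1, h3⟩, h2⟩
      exact ⟨⟨h1, h2⟩, h3⟩
  rw [h1, h2, ENNReal.mul_inv (.inl hc0) (.inl hc), mul_mul_mul_comm,
    ENNReal.inv_mul_cancel hc0 hc, one_mul]

theorem measurable_map_prodMk_translationLaw :
    Measurable fun v : Orientation n k => (translationLaw v).map (Prod.mk v) := by
  refine Measure.measurable_of_measurable_coe _ fun B hB => ?_
  have hslab := measurableSet_normalSlab (n := n) (k := k)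
  have hpre : MeasurableSet {p : Orientation n k × E n | (p.1, normalPart p.1 p.2) ∈ B} :=
    (measurable_fst.prodMk measurable_normalPart) hB
  have : (fun v : Orientation n k => (translationLaw v).map (Prod.mk v) B) = fun v =>
      (volume (Prod.mk v ⁻¹' {p : Orientation n k × E n | p.2 ∈ normalSlab p.1}))⁻¹ *
        volume (Prod.mk v ⁻¹' ({p : Orientation n k × E n | p.2 ∈ normalSlab p.1} ∩
          {p : Orientation n k × E n | (p.1, normalPart p.1 p.2) ∈ B})) := by
    funext v
    have hm := measurable_normalPart_right v
    have hv := measurableSet_normalSlab_right v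
    rw [translationLaw_eq_map_normalPart, Measure.map_apply measurable_prodMk_left hB,
      Measure.map_apply hm (measurable_prodMk_left hB), cond_apply hv]
    rfl
  rw [this]
  exact (measurable_measure_prodMk_left hslab).inv.mul
    (measurable_measure_prodMk_left (hslab.inter hpre))

theorem lintegral_vertexCount_translationLaw {v : Orientation n k}
    (hv : LinearIndependent ℝ (vectors v)) :
    ∫⁻ τ, vertexCount (v, τ) ∂(translationLaw v) = 2 ^ k := by
  have hT := measurableSet_translations v
  have hcount : Measurable fun τ : E n => vertexCount (v, τ) :=
    measurable_vertexCount.comp measurable_prodMk_left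
  have hfin : Module.finrank ℝ (direction v) = k := by
    rw [direction, finrank_span_eq_card hv, Fintype.card_fin]
  rw [translationLaw, lintegral_map hcount measurable_subtype_coe, ProbabilityTheory.cond,
    lintegral_smul_measure, ← lintegral_indicator hT, smul_eq_mul]
  -- Empty slices have no vertices, so restricting to `translations v` loses nothing.
  have hind : (translations v).indicator
      (fun τ : ((direction v)ᗮ : Submodule ℝ (E n)) => vertexCount (v, (τ : E n))) =
      fun τ : ((direction v)ᗮ : Submodule ℝ (E n)) => ((Set.extremePoints ℝ (sliceBy (direction v) (τ : E n))).encard : ℝ≥0∞) := by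
    classical
    funext τ
    have hvc : vertexCount (v, (τ : E n)) =
        ((Set.extremePoints ℝ (sliceBy (direction v) (τ : E n))).encard : ℝ≥0∞) := by
      rw [vertexCount, slice_eq_sliceBy]
    rw [Set.indicator_apply, ← hvc]
    split_ifs with h
    · rfl
    · have hempty : slice v (τ : E n) = ∅ := Set.not_nonempty_iff_eq_empty.1 h
      simp [vertexCount, hempty]
  have hTeq : translations v = {τ : ((direction v)ᗮ : Submodule ℝ (E n)) |
      (sliceBy (direction v) (τ : E n)).Nonempty} := by
    simp only [translations, slice_eq_sliceBy]
  rw [hind, lintegral_encard_extremePoints, hfin, ← hTeq, mul_left_comm,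
    ENNReal.inv_mul_cancel (volume_translations_ne_zero v) (volume_translations_ne_top v), mul_one]

theorem isProbabilityMeasure_randomFlatLaw (μ : Measure (Orientation n k))
    [IsProbabilityMeasure μ] : IsProbabilityMeasure (randomFlatLaw μ) :=
  isProbabilityMeasure_bind measurable_map_prodMk_translationLaw.aemeasurable
    (ae_of_all _ fun _ => Measure.isProbabilityMeasure_map measurable_prodMk_left.aemeasurable)

theorem lintegral_vertexCount_randomFlatLaw (μ : Measure (Orientation n k))
    [IsProbabilityMeasure μ] (hμ : ∀ᵐ v ∂μ, LinearIndependent ℝ (vectors v)) :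
    ∫⁻ p, vertexCount p ∂(randomFlatLaw μ) = 2 ^ k := by
  rw [randomFlatLaw, Measure.lintegral_bind measurable_map_prodMk_translationLaw.aemeasurable
    measurable_vertexCount.aemeasurable]
  calc ∫⁻ v, ∫⁻ p, vertexCount p ∂((translationLaw v).map (Prod.mk v)) ∂μ
      = ∫⁻ _, 2 ^ k ∂μ := by
        refine lintegral_congr_ae ?_
        filter_upwards [hμ] with v hv
        rw [lintegral_map measurable_vertexCount measurable_prodMk_left,
          lintegral_vertexCount_translationLaw hv]
    _ = 2 ^ k := by simp

/-! ### The isotropic distribution -/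

theorem isProbabilityMeasure_sphereUniform (n : ℕ) :
    IsProbabilityMeasure (sphereUniform (n + 1)) := by
  refine cond_isProbabilityMeasure ?_
  rw [Ne, Measure.measure_univ_eq_zero]
  exact Measure.toSphere_ne_zero _

instance isFiniteMeasure_sphereUniform (n : ℕ) : IsFiniteMeasure (sphereUniform n) := by
  rcases n with _ | n
  · have : IsEmpty (Metric.sphere (0 : E 0) 1) := ⟨fun x => by
      have h1 := x.2
      rw [mem_sphere_zero_iff_norm, Subsingleton.elim (x : E 0) 0, norm_zero] at h1
      exact zero_ne_one h1⟩
    exact ⟨by simp [Set.eq_empty_of_isEmpty]⟩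
  · have := isProbabilityMeasure_sphereUniform n
    infer_instance

/-- Surface measure is computed from the cone over a set, and here the cone stays in the null set
`L`. -/
theorem sphereUniform_preimage_submodule {L : Submodule ℝ (E n)} (hL : L ≠ ⊤) :
    sphereUniform n (Subtype.val ⁻¹' (L : Set (E n))) = 0 := by
  have hmeas : MeasurableSet
      (Subtype.val ⁻¹' (L : Set (E n)) : Set (Metric.sphere (0 : E n) 1)) :=
    measurable_subtype_coe (Submodule.closed_of_finiteDimensional L).measurableSet
  refine cond_absolutelyContinuous (μ := (volume : Measure (E n)).toSphere) ?_
  rw [Measure.toSphere_apply' _ hmeas]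
  refine mul_eq_zero_of_right _ (measure_mono_null ?_ (Measure.addHaar_submodule volume L hL))
  rintro _ ⟨r, -, _, ⟨x, hx, rfl⟩, rfl⟩
  exact L.smul_mem r hx

instance isFiniteMeasure_isotropic (n k : ℕ) : IsFiniteMeasure (isotropic n k) := by
  rw [isotropic]
  infer_instance

theorem isProbabilityMeasure_isotropic (h : k ≤ n) : IsProbabilityMeasure (isotropic n k) := by
  rcases n with _ | n
  · obtain rfl : k = 0 := by omega
    rw [isotropic, Measure.pi_of_empty]
    infer_instance
  · have := isProbabilityMeasure_sphereUniform n
    rw [isotropic]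
    infer_instance

theorem measurableSet_linearIndependent_vectors :
    MeasurableSet {v : Orientation n k | LinearIndependent ℝ (vectors v)} := by
  have hc : Continuous (vectors : Orientation n k → Fin k → E n) := by
    unfold vectors; fun_prop
  exact (isOpen_setOfPred_linearIndependent.preimage hc).measurableSet

/-- By Fubini, once `k < n` independent vectors are drawn, a further one almost surely avoids their
proper span. -/
theorem ae_linearIndependent_isotropic (h : k ≤ n) :
    ∀ᵐ v ∂(isotropic n k), LinearIndependent ℝ (vectors v) := by
  induction k with
  | zero => exact ae_of_all _ fun v => linearIndependent_empty_type
  | succ k ih =>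
    have ih := ih (by omega)
    have hmp := measurePreserving_piFinSuccAbove
      (fun _ : Fin (k + 1) => sphereUniform n) 0
    have hmeas : MeasurableSet {p : Metric.sphere (0 : E n) 1 × Orientation n k |
        LinearIndependent ℝ (vectors (Fin.cons p.1 p.2 : Orientation n (k + 1)))} := by
      have hc : Measurable fun p : Metric.sphere (0 : E n) 1 × Orientation n k =>
          (Fin.cons p.1 p.2 : Orientation n (k + 1)) := by
        refine measurable_pi_iff.2 fun j => Fin.cases ?_ (fun j => ?_) j
        · simpa using measurable_fst
        · simp only [Fin.cons_succ]
          exact (measurable_pi_apply j).comp measurable_snd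
      exact hc measurableSet_linearIndependent_vectors
    have hprod : ∀ᵐ p ∂((sphereUniform n).prod (isotropic n k)),
        LinearIndependent ℝ (vectors (Fin.cons p.1 p.2 : Orientation n (k + 1))) := by
      -- The factors are swapped so that the old vectors are fixed before the new one.
      have hswap : ∀ᵐ q ∂((isotropic n k).prod (sphereUniform n)),
          LinearIndependent ℝ (vectors (Fin.cons q.2 q.1 : Orientation n (k + 1))) := by
        refine (Measure.ae_prod_iff_ae_ae (measurable_swap hmeas)).2 ?_
        filter_upwards [ih] with w hw
        have hne : direction w ≠ ⊤ := by
          intro htop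
          have h1 : Module.finrank ℝ (direction w) = k := by
            rw [direction, finrank_span_eq_card hw, Fintype.card_fin]
          rw [htop, finrank_top, finrank_euclideanSpace_fin] at h1
          omega
        filter_upwards [measure_eq_zero_iff_ae_notMem.1 (sphereUniform_preimage_submodule hne)]
          with x hx
        have : vectors (Fin.cons x w : Orientation n (k + 1)) = Fin.cons (x : E n) (vectors w) := by
          funext j
          refine Fin.cases ?_ (fun j => ?_) j <;> simp [vectors]
        change LinearIndependent ℝ (vectors (Fin.cons x w : Orientation n (k + 1)))
        rw [this, linearIndependent_finCons]
        exact ⟨hw, hx⟩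
      exact (Measure.measurePreserving_swap (μ := sphereUniform n)
        (ν := isotropic n k)).quasiMeasurePreserving.ae hswap
    filter_upwards [hmp.quasiMeasurePreserving.ae hprod] with v hv
    convert hv
    exact (Fin.cons_self_tail v).symm

end CubeSlice

theorem mainTheorem2 (n k : ℕ) :
    (∀ μ : Measure (CubeSlice.Orientation n k), IsProbabilityMeasure μ →
      (∀ᵐ v ∂μ, LinearIndependent ℝ (CubeSlice.vectors v)) →
        IsProbabilityMeasure (CubeSlice.randomFlatLaw μ) ∧
        AEMeasurable CubeSlice.vertexCount (CubeSlice.randomFlatLaw μ) ∧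
        ∫⁻ p, CubeSlice.vertexCount p ∂(CubeSlice.randomFlatLaw μ) = 2 ^ k) ∧
    (k ≤ n →
      IsProbabilityMeasure (CubeSlice.isotropic n k) ∧
      (∀ᵐ v ∂(CubeSlice.isotropic n k), LinearIndependent ℝ (CubeSlice.vectors v)) ∧
      IsProbabilityMeasure (CubeSlice.randomFlatLaw (CubeSlice.isotropic n k)) ∧
      AEMeasurable CubeSlice.vertexCount (CubeSlice.randomFlatLaw (CubeSlice.isotropic n k)) ∧
      ∫⁻ p, CubeSlice.vertexCount p ∂(CubeSlice.randomFlatLaw (CubeSlice.isotropic n k)) =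
        2 ^ k) := by
  have main : ∀ μ : Measure (CubeSlice.Orientation n k), IsProbabilityMeasure μ →
      (∀ᵐ v ∂μ, LinearIndependent ℝ (CubeSlice.vectors v)) →
        IsProbabilityMeasure (CubeSlice.randomFlatLaw μ) ∧
        AEMeasurable CubeSlice.vertexCount (CubeSlice.randomFlatLaw μ) ∧
        ∫⁻ p, CubeSlice.vertexCount p ∂(CubeSlice.randomFlatLaw μ) = 2 ^ k :=
    fun μ _ hLI => ⟨CubeSlice.isProbabilityMeasure_randomFlatLaw μ,
      CubeSlice.measurable_vertexCount.aemeasurable,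
      CubeSlice.lintegral_vertexCount_randomFlatLaw μ hLI⟩
  refine ⟨main, fun h => ?_⟩
  have hprob := CubeSlice.isProbabilityMeasure_isotropic h
  have hLI := CubeSlice.ae_linearIndependent_isotropic h
  exact ⟨hprob, hLI, main _ hprob hLI⟩
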